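/- For $k\ge 1$ and real $t\ge 0$, $u>-1$, $\gamma\ge 0$, $\alpha>0$, $\mu$, put $$S(t,u,\gamma,\alpha,\mu)=\sum_{k=1}^{\infty}\frac{2(k+u)^{\gamma}}{((k+u)^{\alpha}+t^{\alpha})^{\mu+1}},\qquad \tilde S(t,u,\gamma,\alpha,\mu)=\sum_{k=1}^{\infty}\frac{2(-1)^{k-1}(k+u)^{\gamma}}{((k+u)^{\alpha}+t^{\alpha})^{\mu+1}},$$ the second series being understood as the limit of its partial sums. Let $E_m(x)$ and $B_m(x)$ be the Euler and Bernoulli polynomials, given by $\frac{2e^{sx}}{e^s+1}=\sum_{m\ge0}E_m(x)\frac{s^m}{m!}$ and $\frac{se^{sx}}{e^s-1}=\sum_{m\ge0}B_m(x)\frac{s^m}{m!}$, and let $B(\cdot,\cdot)$ be the Beta function. Let $\gamma\ge 0$ and $\alpha>0$ be even integers and let $\mu\in\mathbb{R}$ satisfy $\delta:=\alpha(\mu+1)-\gamma>0$. Then the series $\tilde S(t,0,\gamma,\alpha,\mu)$ converges for every $t\ge 0$, and for every natural number $n$ $$\tilde S(t,0,\gamma,\alpha,\mu)=\frac{(-1)^{\gamma}E_{\gamma}(0)}{t^{\alpha(\mu+1)}}+o\!\left(\frac{1}{t^{\alpha(n+\mu+1)}}\right),\qquad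 t\to+\infty .$$ If, in addition, $\delta>1$, then the series $S(t,0,\gamma,\alpha,\mu)$ converges for every $t\ge 0$, and for every natural number $n$ $$S(t,0,\gamma,\alpha,\mu)=\frac{1}{t^{\alpha(\mu+1)-\gamma-1}}\cdot\frac{2}{\alpha}\,B\!\left(\frac{\gamma+1}{\alpha},\,\mu+1-\frac{\gamma+1}{\alpha}\right)+\frac{(-1)^{\gamma}\,2\,B_{\gamma+1}(0)}{(\gamma+1)\,t^{\alpha(\mu+1)}}+o\!\left(\frac{1}{t^{\alpha(n+\mu+1)}}\right),\qquad t\to+\infty .$$ -/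

import Mathlib

open Filter Asymptotics

/-- The terms of the Mathieu series, indexed from `0`: entry `j` is the term with `k = j + 1`,
`2 (k + u) ^ γ / ((k + u) ^ α + t ^ α) ^ (μ + 1)`. -/
noncomputable def mathieuTerm (t u γ α μ : ℝ) (j : ℕ) : ℝ :=
  2 * ((j : ℝ) + 1 + u) ^ γ / (((j : ℝ) + 1 + u) ^ α + t ^ α) ^ (μ + 1)

/-- The terms of the alternating Mathieu series: entry `j` is the term with `k = j + 1`, whose
sign is `(-1) ^ (k - 1) = (-1) ^ j`. -/
noncomputable def altMathieuTerm (t u γ α μ : ℝ) (j : ℕ) : ℝ :=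
  (-1) ^ j * mathieuTerm t u γ α μ j

/-- The Mathieu series `S(t, u, γ, α, μ)`. -/
noncomputable def mathieuS (t u γ α μ : ℝ) : ℝ :=
  ∑' j : ℕ, mathieuTerm t u γ α μ j

/-- The alternating Mathieu series `S̃(t, u, γ, α, μ)`, summed as the limit of its partial sums
(it need not converge absolutely). -/
noncomputable def altMathieuS (t u γ α μ : ℝ) : ℝ :=
  ∑'[SummationFilter.conditional ℕ] j : ℕ, altMathieuTerm t u γ α μ j

/-- The value `E_n(x)` of the `n`-th Euler polynomial, from the generating function
`2 e ^ (x s) / (e ^ s + 1) = ∑ E_n(x) s ^ n / n!`. -/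
noncomputable def eulerPolynomial (n : ℕ) (x : ℝ) : ℝ :=
  (n.factorial : ℝ) *
    PowerSeries.coeff n
      (PowerSeries.C 2 * PowerSeries.rescale x (PowerSeries.exp ℝ) * (PowerSeries.exp ℝ + 1)⁻¹)

/-! With `s = μ + 1`, the sampled function `f x = x ^ γ * (x ^ α + t ^ α) ^ (-s)` is even and, for
`t > 0`, smooth on the whole line. The alternating sum of `f` over all integers is therefore `f 0`
minus the alternating series. A unit shift flips the sign of such a sum, so replacing `f` by its
unit difference doubles it; after `m` differences it is controlled by the `m`-th derivative, of size
`t ^ (-(δ + m - 3/2))` after summation. As `m` is arbitrary, only `f 0 = 0 ^ γ / t ^ (α * s)`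
survives, and `E_γ(0) = 0 ^ γ` for even `γ` (`tendsto_sum_altMathieuTerm`).

For the plain series, homogeneity gives `S̃(2t) = S(2t) - 2 ^ (1 - δ) * S(t)`. Hence the error `E =
S + f 0 - 2 ∫ f` has rapidly decaying dyadic increments once multiplied by `t ^ (δ - 1)`. A crude
comparison with the integral shows that this product tends to `0`, and telescoping over `t, 2t, 4t,
...` transfers the decay to `E` (`exists_abs_mathieuS_sub_le`). The integral is a Beta value, and `2
B_{γ+1}(0) / (γ + 1) = -0 ^ γ`. -/

open scoped ContDiff Topology
open MeasureTheory

/-! ### Unit differences and bilateral alternating sums -/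

/-- The unit-step difference `x ↦ f x - f (x + 1)`. -/
def unitDiff (f : ℝ → ℝ) : ℝ → ℝ := fun x => f x - f (x + 1)

lemma ContDiff.unitDiff {f : ℝ → ℝ} (hf : ContDiff ℝ ∞ f) : ContDiff ℝ ∞ (unitDiff f) := by
  unfold _root_.unitDiff
  fun_prop

lemma iteratedDeriv_unitDiff {f : ℝ → ℝ} (hf : ContDiff ℝ ∞ f) (m : ℕ) (x : ℝ) :
    iteratedDeriv m (unitDiff f) x = iteratedDeriv m f x - iteratedDeriv m f (x + 1) := by
  have hm : ContDiff ℝ m f := hf.of_le (by exact_mod_cast le_top)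
  have hg : ContDiff ℝ m (fun y => f (y + 1)) := by fun_prop
  unfold unitDiff
  rw [iteratedDeriv_fun_sub hm.contDiffAt hg.contDiffAt, iteratedDeriv_comp_add_const]

/-- Mean value inequality, once per difference; each use widens the interval by one. -/
lemma abs_iterate_unitDiff_le {B : ℝ} (m : ℕ) : ∀ {f : ℝ → ℝ} (_ : ContDiff ℝ ∞ f) {x : ℝ}
    (_ : ∀ y ∈ Set.Icc x (x + m), |iteratedDeriv m f y| ≤ B), |unitDiff^[m] f x| ≤ B := by
  induction m with
  | zero =>
    intro f _ x h
    simpa using h x (by simp)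
  | succ m ih =>
    intro f hf x h
    rw [Function.iterate_succ_apply]
    refine ih hf.unitDiff fun y hy => ?_
    rw [iteratedDeriv_unitDiff hf, abs_sub_comm]
    have hd : ∀ z ∈ Set.Icc y (y + 1), HasDerivWithinAt (iteratedDeriv m f)
        (iteratedDeriv (m + 1) f z) (Set.Icc y (y + 1)) z := by
      intro z _
      rw [iteratedDeriv_succ]
      have : Differentiable ℝ (iteratedDeriv m f) :=
        hf.differentiable_iteratedDeriv m (by exact_mod_cast ENat.natCast_lt_top m)
      exact (this z).hasDerivAt.hasDerivWithinAt
    have := Convex.norm_image_sub_le_of_norm_hasDerivWithin_le (C := B) hd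
      (fun z hz => ?_) (convex_Icc _ _) (Set.left_mem_Icc.2 (by linarith))
      (Set.right_mem_Icc.2 (by linarith))
    · simpa using this
    · refine h z ⟨hy.1.trans hz.1, ?_⟩
      have := hy.2
      have := hz.2
      push_cast
      linarith

/-- Partial sums of the bilateral alternating series of `f`. -/
noncomputable def biAltSum (f : ℝ → ℝ) (N : ℕ) : ℝ :=
  ∑ n ∈ Finset.range N, (-1) ^ n * (f n - f (-(n + 1)))

/-- The sum is `∑ (-1) ^ n * f n` over `-N ≤ n < N`. Shifting by one reverses the sign and leaves
only the two boundary terms. -/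
lemma biAltSum_unitDiff (f : ℝ → ℝ) (N : ℕ) :
    biAltSum (unitDiff f) N = 2 * biAltSum f N + (-1) ^ N * (f N - f (-N)) := by
  induction N with
  | zero => simp [biAltSum]
  | succ N ih =>
    unfold biAltSum at *
    rw [Finset.sum_range_succ, Finset.sum_range_succ, ih]
    have : (-((N : ℝ) + 1) + 1) = -N := by ring
    simp only [unitDiff, this, pow_succ]
    push_cast
    ring

/-- The window `-N ≤ n < N` is not symmetric, hence the correction at `N`. -/
lemma biAltSum_of_even {f : ℝ → ℝ} (hf : ∀ x, f (-x) = f x) (N : ℕ) :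
    biAltSum f N = f 0 - 2 * ∑ j ∈ Finset.range N, (-1) ^ j * f (j + 1) - (-1) ^ N * f N := by
  induction N with
  | zero => simp [biAltSum]
  | succ N ih =>
    unfold biAltSum at *
    rw [Finset.sum_range_succ, Finset.sum_range_succ, ih, hf]
    simp only [pow_succ]
    push_cast
    ring

lemma tendsto_neg_one_pow_mul {u : ℕ → ℝ} (hu : Tendsto u atTop (𝓝 0)) :
    Tendsto (fun n => (-1) ^ n * u n) atTop (𝓝 0) := by
  rw [tendsto_zero_iff_norm_tendsto_zero] at hu ⊢
  simpa [norm_mul] using hu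

lemma tendsto_biAltSum_iterate_unitDiff (m : ℕ) : ∀ {f : ℝ → ℝ} (_ : Tendsto f atTop (𝓝 0))
    (_ : Tendsto f atBot (𝓝 0)),
    Tendsto (fun N => biAltSum (unitDiff^[m] f) N - 2 ^ m * biAltSum f N) atTop (𝓝 0) := by
  induction m with
  | zero => intro f _ _; simp
  | succ m ih =>
    intro f h1 h2
    have e1 : Tendsto (unitDiff f) atTop (𝓝 0) := by
      simpa [unitDiff] using! h1.sub (h1.comp (tendsto_atTop_add_const_right atTop (1 : ℝ) tendsto_id))
    have e2 : Tendsto (unitDiff f) atBot (𝓝 0) := by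
      simpa [unitDiff] using! h2.sub (h2.comp (tendsto_atBot_add_const_right atBot (1 : ℝ) tendsto_id))
    have e3 : Tendsto (fun N : ℕ => (-1 : ℝ) ^ N * (f N - f (-N))) atTop (𝓝 0) := by
      refine tendsto_neg_one_pow_mul ?_
      simpa using (h1.comp tendsto_natCast_atTop_atTop).sub
        (h2.comp (tendsto_neg_atTop_atBot.comp tendsto_natCast_atTop_atTop))
    have := (ih e1 e2).add (e3.const_mul (2 ^ m))
    simp only [mul_zero, add_zero] at this
    refine this.congr fun N => ?_
    rw [Function.iterate_succ_apply, biAltSum_unitDiff]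
    ring

lemma summable_max_one_rpow :
    Summable fun n : ℕ => (max (n : ℝ) 1) ^ (-(3 / 2) : ℝ) := by
  rw [← summable_nat_add_iff 1]
  have := (summable_nat_add_iff 1).2 (Real.summable_nat_rpow (p := -(3 / 2)) |>.2 (by norm_num))
  refine this.congr fun n => ?_
  rw [max_eq_left]
  push_cast
  linarith [(Nat.cast_nonneg n : (0 : ℝ) ≤ n)]

/-- An even function whose `m`-th difference is `O(|x| ^ (-3/2))` has a convergent alternating
series `∑ 2 (-1) ^ (k - 1) f k`, equal to `f 0` up to an error bounded by that difference. -/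
lemma exists_tendsto_altSum (m : ℕ) : ∃ K : ℝ, 0 ≤ K ∧ ∀ (f : ℝ → ℝ) (M : ℝ),
    (∀ x, f (-x) = f x) → Tendsto f atTop (𝓝 0) →
    (∀ x, |unitDiff^[m] f x| ≤ M * (max |x| 1) ^ (-(3 / 2) : ℝ)) →
    ∃ L, |L| ≤ M * K ∧
      Tendsto (fun N => ∑ j ∈ Finset.range N, (-1) ^ j * (2 * f (j + 1))) atTop
        (𝓝 (f 0 - L)) := by
  set b : ℕ → ℝ := fun n : ℕ => (max (n : ℝ) 1) ^ (-(3 / 2) : ℝ) with hb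
  have hs : Summable b := summable_max_one_rpow
  have hs' : Summable (fun n => b n + b (n + 1)) := hs.add ((summable_nat_add_iff 1).2 hs)
  have hb0 : ∀ n, 0 ≤ b n := fun n => by positivity
  refine ⟨∑' n, (b n + b (n + 1)), tsum_nonneg fun n => add_nonneg (hb0 _) (hb0 _), ?_⟩
  intro f M hf h1 hM
  have h2 : Tendsto f atBot (𝓝 0) :=
    (h1.comp tendsto_neg_atBot_atTop).congr fun x => hf x
  set g := unitDiff^[m] f with hg
  have hbd : ∀ n : ℕ, ‖(-1 : ℝ) ^ n * (g n - g (-(n + 1)))‖ ≤ M * (b n + b (n + 1)) := by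
    intro n
    have e1 := hM n
    have e2 := hM (-(n + 1))
    rw [abs_neg, abs_of_nonneg (by positivity : (0 : ℝ) ≤ n + 1)] at e2
    rw [abs_of_nonneg (by positivity : (0 : ℝ) ≤ n)] at e1
    have e3 := abs_sub (g n) (g (-(n + 1)))
    simp only [norm_mul, norm_pow, norm_neg, norm_one, one_pow, one_mul, Real.norm_eq_abs]
    simp only [hb]
    push_cast
    linarith
  have hsum := Summable.of_norm_bounded (hs'.mul_left M) hbd
  have hT := hsum.hasSum.tendsto_sum_nat
  have hle := tsum_of_norm_bounded (hs'.hasSum.mul_left M) hbd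
  set L := ∑' n : ℕ, (-1 : ℝ) ^ n * (g n - g (-(n + 1))) with hL
  -- `m` differences multiplied the bilateral sum by `2 ^ m`; the bound simply discards this gain.
  refine ⟨L / 2 ^ m, ?_, ?_⟩
  · rw [abs_div, abs_of_pos (by positivity : (0 : ℝ) < 2 ^ m)]
    exact (div_le_self (abs_nonneg _) (one_le_pow₀ (by norm_num))).trans hle
  · have h3 := (hT.sub (tendsto_biAltSum_iterate_unitDiff m h1 h2)).div_const (2 ^ m)
    have h4 := tendsto_neg_one_pow_mul (h1.comp tendsto_natCast_atTop_atTop)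
    have h5 := ((tendsto_const_nhds (x := f 0)).sub h3).sub h4
    simp only [sub_zero] at h5
    refine h5.congr fun N => ?_
    have h6 := biAltSum_of_even hf N
    have h7 : (∑ n ∈ Finset.range N, (-1 : ℝ) ^ n * (g n - g (-(n + 1)))) = biAltSum g N := rfl
    rw [h7, sub_sub_cancel, mul_div_cancel_left₀ _ (by positivity), h6]
    simp only [Function.comp]
    have h8 : ∑ j ∈ Finset.range N, (-1 : ℝ) ^ j * (2 * f (j + 1)) =
        2 * ∑ j ∈ Finset.range N, (-1 : ℝ) ^ j * f (j + 1) := by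
      rw [Finset.mul_sum]
      exact Finset.sum_congr rfl fun j _ => mul_left_comm _ _ _
    rw [h8]
    ring

/-! ### Homogeneity and derivative bounds for the sampled function -/

/-- The function `x ^ a / (x ^ α + t ^ α) ^ s` sampled by the Mathieu series. -/
noncomputable def mathieuFun (α a : ℕ) (s t x : ℝ) : ℝ :=
  x ^ a * (x ^ α + t ^ α) ^ (-s)

lemma mathieuTerm_eq (γ α : ℕ) (μ t : ℝ) (j : ℕ) (ht : 0 ≤ t) :
    mathieuTerm t 0 γ α μ j = 2 * mathieuFun α γ (μ + 1) t (j + 1) := by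
  unfold mathieuTerm mathieuFun
  rw [add_zero, Real.rpow_natCast, Real.rpow_natCast, Real.rpow_natCast,
    Real.rpow_neg (by positivity)]
  ring

section

variable {α : ℕ}

lemma mathieuFun_neg (hα : Even α) {a : ℕ} (ha : Even a) (s t x : ℝ) :
    mathieuFun α a s t (-x) = mathieuFun α a s t x := by
  simp [mathieuFun, hα.neg_pow, ha.neg_pow]

lemma mathieuFun_scale {a : ℕ} (hα : Even α) (s : ℝ) {c t : ℝ} (x : ℝ) (hc : 0 < c)
    (ht : 0 < t) : mathieuFun α a s (c * t) (c * x) = c ^ (a - α * s) * mathieuFun α a s t x := by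
  unfold mathieuFun
  have : 0 ≤ x ^ α := hα.pow_nonneg x
  rw [mul_pow, mul_pow, mul_pow, ← mul_add, Real.mul_rpow (by positivity) (by positivity),
    sub_eq_add_neg, Real.rpow_add hc, ← mul_neg, Real.rpow_mul hc.le, Real.rpow_natCast,
    Real.rpow_natCast]
  ring

lemma pow_add_pow_pos (hα : Even α) {t : ℝ} (ht : 0 < t) (x : ℝ) : 0 < x ^ α + t ^ α :=
  add_pos_of_nonneg_of_pos (hα.pow_nonneg x) (pow_pos ht α)

lemma contDiff_mathieuFun (hα : Even α) (a : ℕ) (s : ℝ) {t : ℝ} (ht : 0 < t) :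
    ContDiff ℝ ∞ (mathieuFun α a s t) := by
  unfold mathieuFun
  refine ContDiff.mul (by fun_prop) (ContDiff.rpow_const_of_ne (by fun_prop) fun x => ?_)
  exact (pow_add_pow_pos hα ht x).ne'

/-- The family is closed under differentiation, and both terms have degree one lower. At `a = 0` the
truncated `a - 1` is harmless because its coefficient vanishes. -/
lemma deriv_mathieuFun (hα : Even α) (hα0 : 0 < α) (a : ℕ) (s : ℝ) {t : ℝ} (ht : 0 < t) :
    deriv (mathieuFun α a s t) = fun x => a * mathieuFun α (a - 1) s t x -
      s * α * mathieuFun α (a + α - 1) (s + 1) t x := by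
  funext x
  have h1 := (hasDerivAt_pow α x).add_const (t ^ α)
  have h2 := h1.rpow_const (p := -s) (Or.inl (pow_add_pow_pos hα ht x).ne')
  have h3 : HasDerivAt (mathieuFun α a s t) _ x := (hasDerivAt_pow a x).fun_mul h2
  rw [h3.deriv]
  unfold mathieuFun
  rw [Nat.add_sub_assoc (Nat.one_le_of_lt hα0), pow_add, neg_add']
  ring

lemma abs_mathieuFun_le (hα : Even α) (hα0 : 0 < α) (a : ℕ) (s : ℝ) {t : ℝ} (ht : 0 < t) (x : ℝ) :
    |mathieuFun α a s t x| ≤ (x ^ α + t ^ α) ^ (-(α * s - a) / α) := by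
  have hY := pow_add_pow_pos hα ht x
  have hα' : (0 : ℝ) < α := by exact_mod_cast hα0
  unfold mathieuFun
  rw [abs_mul, abs_of_pos (Real.rpow_pos_of_pos hY _), abs_pow]
  have h1 : |x| ^ a = (x ^ α) ^ ((a : ℝ) / α) := by
    rw [← hα.pow_abs x, ← Real.rpow_natCast _ α, ← Real.rpow_mul (abs_nonneg x),
      mul_div_cancel₀ _ hα'.ne', Real.rpow_natCast]
  have h2 : -(α * s - a) / α = (a : ℝ) / α + -s := by field_simp; ring
  rw [h1, h2, Real.rpow_add hY]
  gcongr
  · exact hα.pow_nonneg x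
  · linarith [pow_pos ht α]

/-- Each derivative lowers the homogeneity degree by one; the constant is uniform in both `t` and
`x`. -/
lemma exists_abs_iteratedDeriv_mathieuFun_le (hα : Even α) (hα0 : 0 < α) (m : ℕ) :
    ∀ (a : ℕ) (s : ℝ), ∃ C, 0 ≤ C ∧ ∀ t, 0 < t → ∀ x,
      |iteratedDeriv m (mathieuFun α a s t) x| ≤
        C * (x ^ α + t ^ α) ^ (-(α * s - a + m) / α) := by
  induction m with
  | zero =>
    intro a s
    refine ⟨1, zero_le_one, fun t ht x => ?_⟩
    simpa using abs_mathieuFun_le hα hα0 a s ht x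
  | succ m ih =>
    intro a s
    obtain ⟨C₁, h₁, H₁⟩ := ih (a - 1) s
    obtain ⟨C₂, h₂, H₂⟩ := ih (a + α - 1) (s + 1)
    refine ⟨a * C₁ + |s * α| * C₂, by positivity, fun t ht x => ?_⟩
    have c1 : ContDiff ℝ m (mathieuFun α (a - 1) s t) :=
      (contDiff_mathieuFun hα _ _ ht).of_le (by exact_mod_cast le_top)
    have c2 : ContDiff ℝ m (mathieuFun α (a + α - 1) (s + 1) t) :=
      (contDiff_mathieuFun hα _ _ ht).of_le (by exact_mod_cast le_top)
    rw [iteratedDeriv_succ', deriv_mathieuFun hα hα0 a s ht,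
      iteratedDeriv_fun_sub (contDiff_const.mul c1).contDiffAt (contDiff_const.mul c2).contDiffAt,
      iteratedDeriv_const_mul_field, iteratedDeriv_const_mul_field]
    refine (abs_sub _ _).trans ?_
    rw [add_mul, abs_mul, abs_mul]
    refine add_le_add ?_ ?_
    · rcases Nat.eq_zero_or_pos a with rfl | ha
      · simp
      · rw [Nat.abs_cast, mul_assoc]
        refine mul_le_mul_of_nonneg_left ((H₁ t ht x).trans_eq ?_) (by positivity)
        rw [Nat.cast_sub ha]
        push_cast
        ring_nf
    · rw [mul_assoc]
      refine mul_le_mul_of_nonneg_left ((H₂ t ht x).trans_eq ?_) (by positivity)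
      rw [Nat.cast_sub (by omega)]
      push_cast
      ring_nf

lemma pow_add_pow_rpow_le (hα : Even α) (hα0 : 0 < α) {p t : ℝ} (hp : 0 ≤ p) (ht : 0 < t)
    (x : ℝ) : (x ^ α + t ^ α) ^ (-p / α) ≤ (max |x| t) ^ (-p) := by
  have hα' : (0 : ℝ) < α := by exact_mod_cast hα0
  have hm : 0 < max |x| t := lt_max_of_lt_right ht
  have h1 : (max |x| t) ^ (-p) = ((max |x| t) ^ α) ^ (-p / α) := by
    rw [← Real.rpow_natCast _ α, ← Real.rpow_mul hm.le, mul_div_cancel₀ _ hα'.ne']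
  rw [h1]
  refine Real.rpow_le_rpow_of_nonpos (by positivity) ?_ ?_
  · rcases max_choice |x| t with h | h <;> rw [h]
    · rw [hα.pow_abs]; linarith [pow_pos ht α]
    · linarith [hα.pow_nonneg x]
  · rw [neg_div, neg_nonpos]; positivity

/-- Splits the decay: `q` of the exponent is kept for summability in `y`, the rest becomes decay in
`t`. -/
lemma max_rpow_le_of_one_le {p q t y : ℝ} (hq : 0 ≤ q) (hqp : q ≤ p) (ht : 1 ≤ t) :
    (max y t) ^ (-p) ≤ t ^ (-(p - q)) * (max y 1) ^ (-q) := by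
  have h0 : 0 < max y t := lt_max_of_lt_right (by linarith)
  have h1 : 0 < max y 1 := lt_max_of_lt_right (by linarith)
  have : -p = -(p - q) + -q := by ring
  rw [this, Real.rpow_add h0]
  refine mul_le_mul ?_ ?_ (by positivity) (by positivity)
  · exact Real.rpow_le_rpow_of_nonpos (by linarith) (le_max_right _ _) (by linarith)
  · exact Real.rpow_le_rpow_of_nonpos h1 (max_le_max le_rfl ht) (by linarith)

/-- Counterpart for small `t`, where only summability in `y` matters. -/
lemma max_rpow_le_of_pos {p q t y : ℝ} (hq : 0 ≤ q) (hqp : q ≤ p) (ht : 0 < t) :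
    (max y t) ^ (-p) ≤ (min t 1) ^ (-p) * (max y 1) ^ (-q) := by
  have h0 : 0 < min t 1 := lt_min ht one_pos
  have h1 : 1 ≤ max y 1 := le_max_right _ _
  calc (max y t) ^ (-p) ≤ (min t 1 * max y 1) ^ (-p) := by
        refine Real.rpow_le_rpow_of_nonpos (by positivity) ?_ (by linarith)
        rcases le_total y 1 with h | h
        · rw [max_eq_right h, mul_one]
          exact (min_le_left _ _).trans (le_max_right _ _)
        · rw [max_eq_left h]
          exact (mul_le_of_le_one_left (by linarith) (min_le_right _ _)).trans (le_max_left _ _)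
    _ = (min t 1) ^ (-p) * (max y 1) ^ (-p) := Real.mul_rpow h0.le (by linarith)
    _ ≤ _ := by
        gcongr

lemma max_one_rpow_le_shift {x y : ℝ} {m : ℕ} (hy : y ∈ Set.Icc x (x + m)) {q : ℝ} (hq : 0 ≤ q) :
    (max |y| 1) ^ (-q) ≤ ((m : ℝ) + 1) ^ q * (max |x| 1) ^ (-q) := by
  have hx1 : 0 < max |x| 1 := lt_max_of_lt_right one_pos
  have hy1 : 1 ≤ max |y| 1 := le_max_right _ _
  have hm : (0 : ℝ) ≤ m := Nat.cast_nonneg m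
  have key : max |x| 1 ≤ (m + 1) * max |y| 1 := by
    refine max_le ?_ (by nlinarith)
    have h1 : |x| ≤ |y| + m := by
      have := abs_sub_abs_le_abs_sub x y
      have h2 : |x - y| ≤ m := abs_le.2 ⟨by linarith [hy.2], by linarith [hy.1]⟩
      linarith
    nlinarith [le_max_left |y| 1]
  rw [Real.rpow_neg (by linarith), Real.rpow_neg hx1.le, ← div_eq_mul_inv,
    le_div_iff₀ (by positivity), mul_comm, ← div_eq_mul_inv, div_le_iff₀ (by positivity),
    ← Real.mul_rpow (by positivity) (by linarith)]
  exact Real.rpow_le_rpow hx1.le key hq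

lemma tendsto_mathieuFun_atTop (hα : Even α) (hα0 : 0 < α) {a : ℕ} {s t : ℝ}
    (hδ : 0 < α * s - a) (ht : 0 < t) : Tendsto (mathieuFun α a s t) atTop (𝓝 0) := by
  refine squeeze_zero_norm' ?_ (tendsto_rpow_neg_atTop hδ)
  filter_upwards [eventually_ge_atTop t] with x hx
  have h := (abs_mathieuFun_le hα hα0 a s ht x).trans (pow_add_pow_rpow_le hα hα0 hδ.le ht x)
  rwa [abs_of_nonneg (ht.le.trans hx), max_eq_left hx] at h

/-- The `m`-th difference at `x` sees the derivative on `[x, x + m]`, so the bounds are stated in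
terms of `x`. The exponent `3/2` is spent on summability. -/
lemma exists_abs_iteratedDeriv_mathieuFun_le_of_mem_Icc (hα : Even α) (hα0 : 0 < α) (a : ℕ)
    (s : ℝ) {m : ℕ} (hm : 3 / 2 ≤ α * s - a + m) : ∃ C, 0 ≤ C ∧
      (∀ t, 1 ≤ t → ∀ x y : ℝ, y ∈ Set.Icc x (x + m) →
        |iteratedDeriv m (mathieuFun α a s t) y| ≤
          C * t ^ (-(α * s - a + m - 3 / 2)) * (max |x| 1) ^ (-(3 / 2) : ℝ)) ∧
      (∀ t, 0 < t → ∀ x y : ℝ, y ∈ Set.Icc x (x + m) →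
        |iteratedDeriv m (mathieuFun α a s t) y| ≤
          C * (min t 1) ^ (-(α * s - a + m)) * (max |x| 1) ^ (-(3 / 2) : ℝ)) := by
  obtain ⟨C, hC, H⟩ := exists_abs_iteratedDeriv_mathieuFun_le hα hα0 m a s
  set p : ℝ := α * s - a + m with hp
  have hp0 : 0 ≤ p := by linarith
  have key : ∀ t A x y : ℝ, 0 < t → 0 ≤ A → y ∈ Set.Icc x (x + m) →
      (max |y| t) ^ (-p) ≤ A * (max |y| 1) ^ (-(3 / 2) : ℝ) →
      |iteratedDeriv m (mathieuFun α a s t) y| ≤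
        C * ((m : ℝ) + 1) ^ (3 / 2 : ℝ) * A * (max |x| 1) ^ (-(3 / 2) : ℝ) := by
    intro t A x y ht hA hy h
    have h1 := (pow_add_pow_rpow_le hα hα0 hp0 ht y).trans h
    have h2 := max_one_rpow_le_shift hy (q := 3 / 2) (by norm_num)
    calc _ ≤ C * (A * (((m : ℝ) + 1) ^ (3 / 2 : ℝ) * (max |x| 1) ^ (-(3 / 2) : ℝ))) :=
        (H t ht y).trans
          (mul_le_mul_of_nonneg_left (h1.trans (mul_le_mul_of_nonneg_left h2 hA)) hC)
      _ = _ := by ring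
  refine ⟨C * ((m : ℝ) + 1) ^ (3 / 2 : ℝ), by positivity, fun t ht x y hy => ?_,
    fun t ht x y hy => ?_⟩
  · have ht0 : 0 < t := by linarith
    exact key t _ x y ht0 (by positivity) hy (max_rpow_le_of_one_le (by norm_num) hm ht)
  · exact key t _ x y ht (Real.rpow_nonneg (le_min ht.le zero_le_one) _) hy
      (max_rpow_le_of_pos (by norm_num) hm ht)

end

/-! ### The alternating series -/

lemma hasSum_conditional_nat_iff {f : ℕ → ℝ} {a : ℝ} :
    HasSum f a (SummationFilter.conditional ℕ) ↔
      Tendsto (fun n => ∑ i ∈ Finset.range n, f i) atTop (𝓝 a) := by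
  rw [HasSum, SummationFilter.conditional_filter_eq_map_range, tendsto_map'_iff]
  rfl

lemma tendsto_sum_altMathieuTerm {γ α : ℕ} {μ : ℝ} (hγ : Even γ) (hα : Even α) (hα0 : 0 < α)
    (hδ : 0 < α * (μ + 1) - γ) {m : ℕ} (hm : 2 ≤ m) : ∃ C, 0 ≤ C ∧ ∀ t : ℝ, 0 < t → ∃ L : ℝ,
      HasSum (altMathieuTerm t 0 γ α μ) (mathieuFun α γ (μ + 1) t 0 - L)
        (SummationFilter.conditional ℕ) ∧
      (1 ≤ t → |L| ≤ C * t ^ (-(α * (μ + 1) - γ + m - 3 / 2))) := by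
  obtain ⟨K, hK, H⟩ := exists_tendsto_altSum m
  have hm' : (2 : ℝ) ≤ m := by exact_mod_cast hm
  obtain ⟨C, hC, H1, H2⟩ := exists_abs_iteratedDeriv_mathieuFun_le_of_mem_Icc hα hα0 γ (μ + 1)
    (m := m) (by linarith)
  have hterm : ∀ t : ℝ, 0 < t → altMathieuTerm t 0 γ α μ =
      fun j : ℕ => (-1) ^ j * (2 * mathieuFun α γ (μ + 1) t (j + 1)) := fun t ht => by
    funext j
    rw [altMathieuTerm, mathieuTerm_eq _ _ _ _ _ ht.le]
  refine ⟨C * K, by positivity, fun t ht => ?_⟩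
  have e := mathieuFun_neg hα hγ (μ + 1) t
  have l := tendsto_mathieuFun_atTop hα hα0 hδ ht
  have c := contDiff_mathieuFun hα γ (μ + 1) ht
  by_cases h1 : 1 ≤ t
  · obtain ⟨L, hL, hT⟩ := H _ _ e l fun x => abs_iterate_unitDiff_le m c (H1 t h1 x)
    refine ⟨L, ?_, fun _ => hL.trans_eq (by ring)⟩
    rw [hasSum_conditional_nat_iff, hterm t ht]
    exact hT
  · obtain ⟨L, -, hT⟩ := H _ _ e l fun x => abs_iterate_unitDiff_le m c (H2 t ht x)
    refine ⟨L, ?_, fun h => absurd h h1⟩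
    rw [hasSum_conditional_nat_iff, hterm t ht]
    exact hT

lemma mathieuTerm_zero {γ α : ℕ} (hα0 : 0 < α) (μ : ℝ) (j : ℕ) :
    mathieuTerm 0 0 γ α μ j = 2 * ((j : ℝ) + 1) ^ (-(α * (μ + 1) - γ)) := by
  have hj : (0 : ℝ) < j + 1 := by positivity
  rw [mathieuTerm_eq _ _ _ _ _ le_rfl, mathieuFun, zero_pow hα0.ne', add_zero, neg_sub,
    sub_eq_add_neg, Real.rpow_add hj, ← mul_neg, Real.rpow_mul hj.le, Real.rpow_natCast,
    Real.rpow_natCast]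

lemma summable_altMathieuTerm {γ α : ℕ} {μ : ℝ} (hγ : Even γ) (hα : Even α) (hα0 : 0 < α)
    (hδ : 0 < α * (μ + 1) - γ) {t : ℝ} (ht : 0 ≤ t) :
    Summable (altMathieuTerm t 0 γ α μ) (SummationFilter.conditional ℕ) := by
  rcases ht.eq_or_lt with rfl | ht
  -- At `t = 0` the function may be singular at the origin, so differencing is replaced by the
  -- alternating series test.
  · have hanti : Antitone (mathieuTerm 0 0 γ α μ) := by
      intro i j hij
      rw [mathieuTerm_zero hα0, mathieuTerm_zero hα0]
      refine mul_le_mul_of_nonneg_left ?_ zero_le_two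
      exact Real.rpow_le_rpow_of_nonpos (by positivity) (by gcongr) (by linarith)
    have hlim : Tendsto (mathieuTerm 0 0 γ α μ) atTop (𝓝 0) := by
      have := ((tendsto_rpow_neg_atTop hδ).comp (tendsto_atTop_add_const_right _ (1 : ℝ)
        (tendsto_natCast_atTop_atTop (R := ℝ)))).const_mul 2
      rw [mul_zero] at this
      exact this.congr fun j => (mathieuTerm_zero hα0 μ j).symm
    obtain ⟨l, hl⟩ := hanti.tendsto_alternating_series_of_tendsto_zero hlim
    exact ⟨l, hasSum_conditional_nat_iff.2 hl⟩
  · obtain ⟨C, -, H⟩ := tendsto_sum_altMathieuTerm hγ hα hα0 hδ le_rfl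
    obtain ⟨L, hL, -⟩ := H t ht
    exact hL.summable

/-! ### The integral over the half-line -/

/-- The Beta function as an integral over the half-line, in the form produced by the
substitution `u = 1 / (1 + x ^ α)`. -/
lemma integral_Ioi_mathieuFun_one {α : ℕ} (hα0 : 0 < α) {a : ℕ} {s : ℝ}
    (hδ : 1 < α * s - a) :
    ∫ x in Set.Ioi 0, mathieuFun α a s 1 x =
      1 / α * ProbabilityTheory.beta (((a : ℝ) + 1) / α) (s - ((a : ℝ) + 1) / α) := by
  have hα' : (0 : ℝ) < α := by exact_mod_cast hα0
  set p : ℝ := ((a : ℝ) + 1) / α with hp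
  have hpα : p * α = a + 1 := div_mul_cancel₀ _ hα'.ne'
  set q : ℝ := s - p with hq
  have hp0 : 0 < p := by positivity
  have hq0 : 0 < q := by
    rw [hq, sub_pos, hp, div_lt_iff₀ hα']
    linarith
  let φ : ℝ → ℝ := fun x => (1 + x ^ α)⁻¹
  let g : ℝ → ℝ := fun u => u ^ (q - 1) * (1 - u) ^ (p - 1)
  have hY : ∀ x ∈ Set.Ioi (0 : ℝ), 1 < 1 + x ^ α := fun x hx => by
    have : 0 < x ^ α := pow_pos hx α
    linarith
  have hinj : Set.InjOn φ (Set.Ioi 0) := by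
    intro x (hx : 0 < x) y (hy : 0 < y) h
    have h1 : x ^ α = y ^ α := by simpa [φ] using h
    exact (pow_left_inj₀ hx.le hy.le hα0.ne').1 h1
  have himg : φ '' Set.Ioi 0 = Set.Ioo 0 1 := by
    ext u
    constructor
    · rintro ⟨x, hx, rfl⟩
      exact ⟨inv_pos.2 (by linarith [hY x hx]), inv_lt_one_of_one_lt₀ (hY x hx)⟩
    · rintro ⟨h0, h1⟩
      have h2 : 0 < u⁻¹ - 1 := sub_pos.2 ((one_lt_inv₀ h0).2 h1)
      refine ⟨(u⁻¹ - 1) ^ ((α : ℝ)⁻¹), Real.rpow_pos_of_pos h2 _, ?_⟩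
      simp only [φ]
      rw [Real.rpow_inv_natCast_pow h2.le hα0.ne']
      simp
  have hder : ∀ x ∈ Set.Ioi (0 : ℝ), HasDerivWithinAt φ
      (-(α * x ^ (α - 1)) / (1 + x ^ α) ^ 2) (Set.Ioi 0) x := fun x hx => by
    have h1 := (hasDerivAt_pow α x).const_add 1
    exact (h1.inv (by linarith [hY x hx])).hasDerivWithinAt
  have hcv := integral_image_eq_integral_abs_deriv_smul measurableSet_Ioi hder hinj g
  have hR : ∀ x ∈ Set.Ioi (0 : ℝ), |-(α * x ^ (α - 1)) / (1 + x ^ α) ^ 2| • g (φ x) =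
      α * mathieuFun α a s 1 x := by
    intro x hx
    have hx' : 0 < x := hx
    have hY0 : 0 < 1 + x ^ α := by linarith [hY x hx]
    have h1 : 1 - φ x = x ^ α * (1 + x ^ α)⁻¹ := by
      simp only [φ]; field_simp; ring
    have h2 : |-(α * x ^ (α - 1)) / (1 + x ^ α) ^ 2| =
        α * x ^ ((α : ℝ) - 1) * (1 + x ^ α) ^ (-2 : ℝ) := by
      rw [abs_div, abs_neg, abs_of_pos (by positivity), abs_of_pos (by positivity),
        Real.rpow_neg hY0.le, div_eq_mul_inv, Real.rpow_sub_one hx'.ne', Real.rpow_natCast,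
        Real.rpow_two, ← pow_sub_one_mul hα0.ne' x, mul_div_cancel_right₀ _ hx'.ne']
    rw [h2, smul_eq_mul]
    simp only [g]
    rw [h1]
    simp only [φ]
    rw [Real.mul_rpow (by positivity) (by positivity), Real.inv_rpow hY0.le, Real.inv_rpow hY0.le,
      ← Real.rpow_neg hY0.le, ← Real.rpow_neg hY0.le, ← Real.rpow_natCast x α,
      ← Real.rpow_mul hx'.le]
    simp only [mathieuFun]
    rw [one_pow, add_comm (x ^ α) 1, ← Real.rpow_natCast x α] at *
    have e1 : x ^ ((α : ℝ) - 1) * x ^ ((α : ℝ) * (p - 1)) = x ^ a := by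
      rw [← Real.rpow_add hx', ← Real.rpow_natCast x a]
      congr 1
      linarith
    have e2 : (1 + x ^ (α : ℝ)) ^ (-2 : ℝ) * ((1 + x ^ (α : ℝ)) ^ (-(q - 1)) *
        (1 + x ^ (α : ℝ)) ^ (-(p - 1))) = (1 + x ^ (α : ℝ)) ^ (-s) := by
      rw [← Real.rpow_add hY0, ← Real.rpow_add hY0]
      congr 1
      linarith
    rw [← e1, ← e2]
    ring
  rw [himg, setIntegral_congr_fun measurableSet_Ioi hR, integral_const_mul] at hcv
  have hbeta : ProbabilityTheory.beta p q = ∫ u in Set.Ioo 0 1, g u := by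
    -- The substitution produces the exponents in the order `q`, `p`, so symmetry of Beta is needed.
    have : ProbabilityTheory.beta p q = ProbabilityTheory.beta q p := by
      simp only [ProbabilityTheory.beta]
      rw [mul_comm, add_comm]
    rw [this, ProbabilityTheory.beta_eq_betaIntegralReal q p hq0 hp0, Complex.betaIntegral,
      intervalIntegral.integral_of_le zero_le_one, integral_Ioc_eq_integral_Ioo]
    have hc : ∀ u ∈ Set.Ioo (0 : ℝ) 1, (u : ℂ) ^ ((q : ℂ) - 1) * (1 - (u : ℂ)) ^ ((p : ℂ) - 1) =
        ((g u : ℝ) : ℂ) := by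
      intro u hu
      simp only [g]
      rw [Complex.ofReal_mul, Complex.ofReal_cpow hu.1.le, Complex.ofReal_cpow (by linarith [hu.2])]
      push_cast
      rfl
    rw [setIntegral_congr_fun measurableSet_Ioo hc, integral_complex_ofReal, Complex.ofReal_re]
  rw [hbeta, hcv]
  field_simp

section

variable {α : ℕ}

lemma integral_Ioi_mathieuFun (hα : Even α) {a : ℕ} (s : ℝ) {t : ℝ} (ht : 0 < t) :
    ∫ x in Set.Ioi 0, mathieuFun α a s t x =
      t ^ (-(α * s - a - 1)) * ∫ x in Set.Ioi 0, mathieuFun α a s 1 x := by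
  have h := integral_comp_mul_left_Ioi' (mathieuFun α a s t) 0 ht
  rw [mul_zero] at h
  rw [← h]
  have h2 : ∀ x, mathieuFun α a s t (t * x) = t ^ (a - α * s) * mathieuFun α a s 1 x := fun x => by
    simpa using mathieuFun_scale hα (a := a) s x ht one_pos
  simp only [h2]
  rw [integral_const_mul, smul_eq_mul, ← mul_assoc]
  congr 1
  rw [show -(α * s - a - 1) = 1 + (a - α * s) by ring, Real.rpow_add ht, Real.rpow_one]

lemma integrableOn_mathieuFun (hα : Even α) (hα0 : 0 < α) {a : ℕ} {s t : ℝ}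
    (hδ : 1 < α * s - a) (ht : 0 < t) : IntegrableOn (mathieuFun α a s t) (Set.Ioi 0) := by
  have hc : Continuous (mathieuFun α a s t) := (contDiff_mathieuFun hα a s ht).continuous
  rw [← Set.Ioc_union_Ioi_eq_Ioi ht.le]
  refine IntegrableOn.union (hc.integrableOn_Icc.mono_set Set.Ioc_subset_Icc_self) ?_
  refine Integrable.mono' (integrableOn_Ioi_rpow_of_lt (neg_lt_neg hδ) ht)
    hc.aestronglyMeasurable ?_
  refine (ae_restrict_iff' measurableSet_Ioi).2 (Eventually.of_forall fun x hx => ?_)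
  have hx' : t < x := hx
  have h := (abs_mathieuFun_le hα hα0 a s ht x).trans
    (pow_add_pow_rpow_le hα hα0 (by linarith) ht x)
  rwa [abs_of_pos (ht.trans hx'), max_eq_left hx'.le] at h

end

/-! ### The non-alternating series -/

lemma abs_sub_intervalIntegral_le {f : ℝ → ℝ} (hf : ContDiff ℝ ∞ f) {x B : ℝ}
    (h : ∀ y ∈ Set.Icc x (x + 1), |deriv f y| ≤ B) :
    |f (x + 1) - ∫ y in x..x + 1, f y| ≤ B := by
  have hd : Differentiable ℝ f := hf.differentiable (by simp)
  have h1 : f (x + 1) - ∫ y in x..x + 1, f y = ∫ y in x..x + 1, (f (x + 1) - f y) := by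
    rw [intervalIntegral.integral_sub (by simp) (hf.continuous.intervalIntegrable _ _)]
    simp
  have hB : 0 ≤ B := (abs_nonneg _).trans (h x (Set.left_mem_Icc.2 (by linarith)))
  have h2 : ∀ y ∈ Set.uIoc x (x + 1), ‖f (x + 1) - f y‖ ≤ B := by
    intro y hy
    rw [Set.uIoc_of_le (by linarith)] at hy
    have := Convex.norm_image_sub_le_of_norm_deriv_le (C := B) (fun z _ => hd z) h
      (convex_Icc _ _) (⟨hy.1.le, hy.2⟩ : y ∈ Set.Icc x (x + 1))
      (Set.right_mem_Icc.2 (by linarith))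
    refine this.trans (mul_le_of_le_one_right hB ?_)
    rw [Real.norm_of_nonneg (by linarith [hy.2])]
    linarith [hy.1]
  rw [h1]
  simpa using intervalIntegral.norm_integral_le_of_norm_le_const h2

/-- Telescoping along `t, 2t, 4t, ...` gives a geometric series of ratio `2 ^ (-q) ≤ 1/2`, whose sum
is at most `C * t ^ (-q)`. -/
lemma abs_le_of_dyadic_increment {e : ℝ → ℝ} (h0 : Tendsto e atTop (𝓝 0)) {C q : ℝ}
    (hC : 0 ≤ C) (hq : 1 ≤ q) (h : ∀ t, 1 ≤ t → |e (2 * t) - e t| ≤ C * (2 * t) ^ (-q)) {t : ℝ}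
    (ht : 1 ≤ t) : |e t| ≤ C * t ^ (-q) := by
  have hhalf : ∀ t : ℝ, 1 ≤ t → 2 * (C * (2 * t) ^ (-q)) ≤ C * t ^ (-q) := by
    intro t ht
    have h2 : (2 : ℝ) ^ (-q) ≤ 2⁻¹ := by
      rw [← Real.rpow_neg_one]
      exact Real.rpow_le_rpow_of_exponent_le one_le_two (by linarith)
    rw [Real.mul_rpow zero_le_two (by linarith)]
    have h3 : 0 ≤ C * t ^ (-q) := by positivity
    nlinarith
  have hJ : ∀ J : ℕ, ∀ t : ℝ, 1 ≤ t → |e t| ≤ C * t ^ (-q) + |e (2 ^ J * t)| := by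
    intro J
    induction J with
    | zero =>
      intro t ht
      have : 0 ≤ C * t ^ (-q) := by positivity
      simpa using this
    | succ J ih =>
      intro t ht
      have h1 := ih (2 * t) (by linarith)
      rw [← mul_assoc, ← pow_succ] at h1
      have h2 := h t ht
      have h3 := abs_sub_abs_le_abs_sub (e t) (e (2 * t))
      rw [abs_sub_comm] at h3
      linarith [hhalf t ht]
  have hlim : Tendsto (fun J : ℕ => C * t ^ (-q) + |e (2 ^ J * t)|) atTop
      (𝓝 (C * t ^ (-q) + |0|)) := by
    refine tendsto_const_nhds.add (Tendsto.abs (h0.comp ?_))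
    exact (tendsto_pow_atTop_atTop_of_one_lt one_lt_two).atTop_mul_const (by linarith)
  rw [abs_zero, add_zero] at hlim
  exact ge_of_tendsto' hlim fun J => hJ J t ht

lemma summable_mathieuTerm {γ α : ℕ} {μ : ℝ} (hα : Even α) (hα0 : 0 < α)
    (hδ : 1 < α * (μ + 1) - γ) {t : ℝ} (ht : 0 ≤ t) : Summable (mathieuTerm t 0 γ α μ) := by
  have hs : Summable fun j : ℕ => 2 * ((j : ℝ) + 1) ^ (-(α * (μ + 1) - γ)) := by
    have := (summable_nat_add_iff 1).2 (Real.summable_nat_rpow.2 (neg_lt_neg hδ))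
    push_cast at this
    exact this.mul_left 2
  rcases ht.eq_or_lt with rfl | ht
  · exact hs.congr fun j => (mathieuTerm_zero hα0 μ j).symm
  · refine Summable.of_norm_bounded hs fun j => ?_
    have hj : (0 : ℝ) < j + 1 := by positivity
    rw [mathieuTerm_eq _ _ _ _ _ ht.le, norm_mul, Real.norm_two, Real.norm_eq_abs]
    refine mul_le_mul_of_nonneg_left ?_ zero_le_two
    refine ((abs_mathieuFun_le hα hα0 γ (μ + 1) ht _).trans
      (pow_add_pow_rpow_le hα hα0 (by linarith) ht _)).trans ?_
    refine Real.rpow_le_rpow_of_nonpos hj ?_ (by linarith)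
    rw [abs_of_pos hj]
    exact le_max_left _ _

/-- First-derivative comparison of sum and integral. It is crude, but it beats `t ^ (-(δ - 1))`,
which is all the telescoping needs. -/
lemma exists_abs_mathieuS_sub_integral_le {γ α : ℕ} {μ : ℝ} (hα : Even α) (hα0 : 0 < α)
    (hδ : 1 < α * (μ + 1) - γ) : ∃ C, ∀ t : ℝ, 1 ≤ t →
      |mathieuS t 0 γ α μ - 2 * ∫ x in Set.Ioi 0, mathieuFun α γ (μ + 1) t x| ≤
        C * t ^ (-(α * (μ + 1) - γ - 1 / 2)) := by
  obtain ⟨C, hC, H, -⟩ := exists_abs_iteratedDeriv_mathieuFun_le_of_mem_Icc hα hα0 γ (μ + 1)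
    (m := 1) (by push_cast; linarith)
  refine ⟨2 * C * ∑' n : ℕ, (max (n : ℝ) 1) ^ (-(3 / 2) : ℝ), fun t ht => ?_⟩
  have ht0 : 0 < t := by linarith
  set f := mathieuFun α γ (μ + 1) t with hf
  have hfc : ContDiff ℝ ∞ f := contDiff_mathieuFun hα γ (μ + 1) ht0
  set T : ℝ := t ^ (-(α * (μ + 1) - γ - 1 / 2)) with hT
  have hT0 : 0 ≤ T := by positivity
  have hterm : ∀ j : ℕ, |f (j + 1) - ∫ y in (j : ℝ)..j + 1, f y| ≤
      C * T * (max (j : ℝ) 1) ^ (-(3 / 2) : ℝ) := by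
    intro j
    refine abs_sub_intervalIntegral_le hfc fun y hy => ?_
    have := H t ht j y (by simpa using hy)
    rw [iteratedDeriv_one, Nat.abs_cast] at this
    refine this.trans_eq ?_
    rw [hT]
    push_cast
    ring_nf
  have h1 := (summable_mathieuTerm hα hα0 hδ ht0.le).hasSum.tendsto_sum_nat
  have h2 := (intervalIntegral_tendsto_integral_Ioi 0
    (integrableOn_mathieuFun hα hα0 hδ ht0) tendsto_natCast_atTop_atTop).const_mul 2
  refine le_of_tendsto' (h1.sub h2).abs fun N => ?_
  have h3 : ∫ y in (0 : ℝ)..N, f y = ∑ j ∈ Finset.range N, ∫ y in (j : ℝ)..j + 1, f y := by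
    have := intervalIntegral.sum_integral_adjacent_intervals (μ := volume) (f := f)
      (a := fun k : ℕ => (k : ℝ)) (n := N) fun k _ => hfc.continuous.intervalIntegrable _ _
    push_cast at this
    exact this.symm
  have h4 : (∑ j ∈ Finset.range N, mathieuTerm t 0 γ α μ j) =
      ∑ j ∈ Finset.range N, 2 * f (j + 1) :=
    Finset.sum_congr rfl fun j _ => mathieuTerm_eq _ _ _ _ _ ht0.le
  rw [h3, h4, Finset.mul_sum, ← Finset.sum_sub_distrib]
  refine (Finset.abs_sum_le_sum_abs _ _).trans ?_
  calc _ ≤ ∑ j ∈ Finset.range N, 2 * C * T * (max (j : ℝ) 1) ^ (-(3 / 2) : ℝ) := by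
        refine Finset.sum_le_sum fun j _ => ?_
        rw [← mul_sub, abs_mul, abs_two, mul_assoc 2 C T, mul_assoc 2]
        exact mul_le_mul_of_nonneg_left (hterm j) zero_le_two
    _ = 2 * C * T * ∑ j ∈ Finset.range N, (max (j : ℝ) 1) ^ (-(3 / 2) : ℝ) :=
        (Finset.mul_sum _ _ _).symm
    _ ≤ 2 * C * T * ∑' n : ℕ, (max (n : ℝ) 1) ^ (-(3 / 2) : ℝ) := by
        refine mul_le_mul_of_nonneg_left ?_ (by positivity)
        exact summable_max_one_rpow.sum_le_tsum _ fun _ _ => by positivity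
    _ = _ := by ring

/-- Splitting off the even indices turns the alternating series into a difference of two
non-alternating ones. -/
lemma hasSum_altMathieuTerm_two_mul {γ α : ℕ} {μ : ℝ} (hα : Even α) (hα0 : 0 < α)
    (hδ : 1 < α * (μ + 1) - γ) {t : ℝ} (ht : 0 < t) :
    HasSum (altMathieuTerm (2 * t) 0 γ α μ)
      (mathieuS (2 * t) 0 γ α μ - 2 ^ (1 - (α * (μ + 1) - γ)) * mathieuS t 0 γ α μ)
      (SummationFilter.conditional ℕ) := by
  have ht2 : 0 < 2 * t := by positivity
  have hs := summable_mathieuTerm hα hα0 hδ ht.le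
  have hs2 := summable_mathieuTerm hα hα0 hδ ht2.le
  set G := mathieuTerm (2 * t) 0 γ α μ with hG
  -- Index `2 * k + 1` carries the even integer `2 * (k + 1)`, since indices start at `0`.
  have hodd : ∀ k : ℕ, G (2 * k + 1) = 2 ^ (γ - α * (μ + 1)) * mathieuTerm t 0 γ α μ k := by
    intro k
    rw [hG, mathieuTerm_eq _ _ _ _ _ ht2.le, mathieuTerm_eq _ _ _ _ _ ht.le]
    have : ((2 * k + 1 : ℕ) : ℝ) + 1 = 2 * (k + 1) := by push_cast; ring
    rw [this, mathieuFun_scale hα (μ + 1) _ two_pos ht]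
    ring
  have ho : HasSum (fun k => G (2 * k + 1)) (2 ^ (γ - α * (μ + 1)) * mathieuS t 0 γ α μ) :=
    (hs.hasSum.mul_left _).congr_fun hodd
  have he : Summable fun k => G (2 * k) := hs2.comp_injective fun a b h => by simpa using h
  have hsum := (he.hasSum.even_add_odd ho).unique hs2.hasSum
  have e1 : HasSum (fun k => altMathieuTerm (2 * t) 0 γ α μ (2 * k)) (∑' k, G (2 * k)) :=
    he.hasSum.congr_fun fun k => by simp [altMathieuTerm, hG]
  have e2 : HasSum (fun k => altMathieuTerm (2 * t) 0 γ α μ (2 * k + 1))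
      (-(2 ^ (γ - α * (μ + 1)) * mathieuS t 0 γ α μ)) :=
    ho.neg.congr_fun fun k => by simp [altMathieuTerm, hG, pow_succ]
  have := (e1.even_add_odd e2).tendsto_sum_nat
  rw [hasSum_conditional_nat_iff]
  convert this using 2
  have h2 : (2 : ℝ) ^ (1 - (α * (μ + 1) - γ)) = 2 * 2 ^ (γ - α * (μ + 1)) := by
    rw [show 1 - (α * (μ + 1) - γ) = 1 + (γ - α * (μ + 1)) by ring, Real.rpow_add two_pos,
      Real.rpow_one]
  have h3 : mathieuS (2 * t) 0 γ α μ = ∑' k, G k := rfl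
  rw [h2, h3, ← hsum]
  ring

lemma exists_abs_mathieuS_sub_le {γ α : ℕ} {μ : ℝ} (hγ : Even γ) (hα : Even α) (hα0 : 0 < α)
    (hδ : 1 < α * (μ + 1) - γ) {m : ℕ} (hm : 2 ≤ m) : ∃ C, ∀ t : ℝ, 1 ≤ t →
      |mathieuS t 0 γ α μ + mathieuFun α γ (μ + 1) t 0 -
          2 * ∫ x in Set.Ioi 0, mathieuFun α γ (μ + 1) t x| ≤
        C * t ^ (-(α * (μ + 1) - γ + m - 3 / 2)) := by
  obtain ⟨C, hC, H⟩ := tendsto_sum_altMathieuTerm hγ hα hα0 (by linarith) hm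
  obtain ⟨C', H'⟩ := exists_abs_mathieuS_sub_integral_le hα hα0 hδ
  have hm' : (2 : ℝ) ≤ m := by exact_mod_cast hm
  set δ : ℝ := α * (μ + 1) - γ with hδd
  set E : ℝ → ℝ := fun t => mathieuS t 0 γ α μ + mathieuFun α γ (μ + 1) t 0 -
    2 * ∫ x in Set.Ioi 0, mathieuFun α γ (μ + 1) t x with hE
  have hlim : Tendsto (fun t => t ^ (δ - 1) * E t) atTop (𝓝 0) := by
    have hb : Tendsto (fun t : ℝ => C' * t ^ (-(1 / 2) : ℝ) + t ^ (-1 : ℝ)) atTop (𝓝 0) := by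
      simpa using ((tendsto_rpow_neg_atTop (by norm_num : (0 : ℝ) < 1 / 2)).const_mul C').add
        (tendsto_rpow_neg_atTop one_pos)
    refine squeeze_zero_norm' ?_ hb
    filter_upwards [eventually_ge_atTop 1] with t ht
    have ht0 : 0 < t := by linarith
    have h0 := (abs_mathieuFun_le hα hα0 γ (μ + 1) ht0 0).trans
      (pow_add_pow_rpow_le hα hα0 (by linarith) ht0 0)
    rw [abs_zero, max_eq_right ht0.le] at h0
    have hEt : |E t| ≤ C' * t ^ (-(δ - 1 / 2)) + t ^ (-δ) := by
      have h1 : E t = (mathieuS t 0 γ α μ -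
        2 * ∫ x in Set.Ioi 0, mathieuFun α γ (μ + 1) t x) + mathieuFun α γ (μ + 1) t 0 := by
        simp only [hE]; ring
      rw [h1]
      exact (abs_add_le _ _).trans (add_le_add (H' t ht) h0)
    have hp : 0 ≤ t ^ (δ - 1) := by positivity
    rw [norm_mul, Real.norm_of_nonneg hp, Real.norm_eq_abs]
    refine (mul_le_mul_of_nonneg_left hEt hp).trans_eq ?_
    rw [mul_add, mul_left_comm, ← Real.rpow_add ht0, ← Real.rpow_add ht0]
    ring_nf
  have hinc : ∀ t : ℝ, 1 ≤ t → |(2 * t) ^ (δ - 1) * E (2 * t) - t ^ (δ - 1) * E t| ≤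
      C * (2 * t) ^ (-((m : ℝ) - 1 / 2)) := by
    intro t ht
    have ht0 : 0 < t := by linarith
    have ht2 : 0 < 2 * t := by linarith
    obtain ⟨L, hL, hLb⟩ := H (2 * t) ht2
    have hu := hL.unique (hasSum_altMathieuTerm_two_mul hα hα0 hδ ht0)
    rw [← hδd] at hu
    have h0 : mathieuFun α γ (μ + 1) (2 * t) 0 = 2 ^ (-δ) * mathieuFun α γ (μ + 1) t 0 := by
      have := mathieuFun_scale hα (a := γ) (μ + 1) 0 two_pos ht0
      rw [mul_zero] at this
      rw [this, hδd, neg_sub]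
    have hI : ∫ x in Set.Ioi 0, mathieuFun α γ (μ + 1) (2 * t) x =
        2 ^ (1 - δ) * ∫ x in Set.Ioi 0, mathieuFun α γ (μ + 1) t x := by
      -- The integral scales by exactly `2 ^ (1 - δ)`, so it drops out of the recursion for `E`.
      rw [integral_Ioi_mathieuFun hα _ ht2, integral_Ioi_mathieuFun hα _ ht0, ← hδd,
        Real.mul_rpow zero_le_two ht0.le, neg_sub, mul_assoc]
    have h2 : (2 : ℝ) ^ (1 - δ) = 2 * 2 ^ (-δ) := by
      rw [sub_eq_add_neg, Real.rpow_add two_pos, Real.rpow_one]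
    have hrec : E (2 * t) - 2 ^ (1 - δ) * E t = -L := by
      simp only [hE]
      rw [hI, h0]
      rw [h0] at hu
      rw [h2] at hu ⊢
      linarith
    have h3 : (2 : ℝ) ^ (δ - 1) * 2 ^ (1 - δ) = 1 := by
      rw [← Real.rpow_add two_pos]; simp
    have h4 : (2 * t) ^ (δ - 1) * E (2 * t) - t ^ (δ - 1) * E t = -((2 * t) ^ (δ - 1) * L) := by
      have h5 : (2 * t) ^ (δ - 1) * 2 ^ (1 - δ) = t ^ (δ - 1) := by
        rw [Real.mul_rpow zero_le_two ht0.le, mul_right_comm, h3, one_mul]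
      rw [← mul_neg, ← hrec, ← h5]
      ring
    have hp : 0 ≤ (2 * t) ^ (δ - 1) := by positivity
    rw [h4, abs_neg, abs_mul, abs_of_nonneg hp]
    refine (mul_le_mul_of_nonneg_left (hLb (by linarith)) hp).trans_eq ?_
    rw [mul_left_comm, ← Real.rpow_add ht2]
    ring_nf
  refine ⟨C, fun t ht => ?_⟩
  have ht0 : 0 < t := by linarith
  have h := abs_le_of_dyadic_increment hlim hC (by linarith) hinc ht
  rw [abs_mul, abs_of_pos (by positivity : 0 < t ^ (δ - 1))] at h
  have h1 : t ^ (-(δ - 1)) * t ^ (δ - 1) = 1 := by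
    rw [← Real.rpow_add ht0]; simp
  calc |E t| = t ^ (-(δ - 1)) * (t ^ (δ - 1) * |E t|) := by rw [← mul_assoc, h1, one_mul]
    _ ≤ t ^ (-(δ - 1)) * (C * t ^ (-((m : ℝ) - 1 / 2))) :=
        mul_le_mul_of_nonneg_left h (by positivity)
    _ = _ := by
        rw [mul_left_comm, ← Real.rpow_add ht0]
        ring_nf

/-! ### Euler and Bernoulli values at zero -/

lemma PowerSeries.inv_exp_add_one_add_evalNegHom :
    (PowerSeries.exp ℝ + 1)⁻¹ + PowerSeries.evalNegHom (PowerSeries.exp ℝ + 1)⁻¹ = 1 := by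
  set u : PowerSeries ℝ := (PowerSeries.exp ℝ + 1)⁻¹ with hu
  have hc : PowerSeries.constantCoeff (PowerSeries.exp ℝ + 1) ≠ 0 := by
    simp
  have h1 : (PowerSeries.exp ℝ + 1) * u = 1 := PowerSeries.mul_inv_cancel _ hc
  have h2 : (PowerSeries.evalNegHom (PowerSeries.exp ℝ) + 1) * PowerSeries.evalNegHom u = 1 := by
    have := congrArg PowerSeries.evalNegHom h1
    simpa using this
  have h3 := PowerSeries.exp_mul_exp_neg_eq_one (A := ℝ)
  have h0 : PowerSeries.exp ℝ + 1 ≠ 0 := fun h => hc (by rw [h, map_zero])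
  refine mul_left_cancel₀ h0 ?_
  linear_combination h1 + PowerSeries.exp ℝ * h2 - PowerSeries.evalNegHom u * h3

/-- By `1 / (e ^ s + 1) + 1 / (e ^ (-s) + 1) = 1`, the even part of `2 / (e ^ s + 1)` is the
constant `1`. -/
lemma eulerPolynomial_zero_of_even {n : ℕ} (hn : Even n) : eulerPolynomial n 0 = 0 ^ n := by
  have h := congrArg (PowerSeries.coeff n) PowerSeries.inv_exp_add_one_add_evalNegHom
  rw [map_add, PowerSeries.evalNegHom, PowerSeries.coeff_rescale, hn.neg_one_pow, one_mul,
    PowerSeries.coeff_one] at h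
  have h1 : PowerSeries.rescale (0 : ℝ) (PowerSeries.exp ℝ) = 1 := by
    rw [PowerSeries.rescale_zero_apply]
    simp
  rw [eulerPolynomial, h1, mul_one, PowerSeries.coeff_C_mul, two_mul, h]
  rcases Nat.eq_zero_or_pos n with rfl | hn0
  · simp
  · simp [hn0.ne']

/-- Odd-index Bernoulli numbers vanish except `B_1 = -1/2`, which gives the case `n = 0`. -/
lemma two_mul_aeval_zero_bernoulli_succ_of_even {n : ℕ} (hn : Even n) :
    2 * Polynomial.aeval (0 : ℝ) (Polynomial.bernoulli (n + 1)) / ((n : ℝ) + 1) = -0 ^ n := by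
  have h : Polynomial.aeval (0 : ℝ) (Polynomial.bernoulli (n + 1)) =
      ((bernoulli (n + 1) : ℚ) : ℝ) := by
    rw [← Polynomial.bernoulli_eval_zero, ← map_zero (algebraMap ℚ ℝ),
      Polynomial.aeval_algebraMap_apply_eq_algebraMap_eval]
    rfl
  rw [h]
  rcases Nat.eq_zero_or_pos n with rfl | hn0
  · norm_num
  · rw [bernoulli_eq_zero_of_odd hn.add_one (by omega)]
    simp [hn0.ne']

/-! ### Assembly of the asymptotics -/

lemma isLittleO_one_div_rpow_of_abs_le {e : ℝ → ℝ} {C p q : ℝ} (hpq : p < q)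
    (h : ∀ t, 1 ≤ t → |e t| ≤ C * t ^ (-q)) :
    e =o[atTop] fun t : ℝ => 1 / t ^ p := by
  have h1 : e =O[atTop] fun t : ℝ => t ^ (-q) := by
    refine IsBigO.of_bound C ?_
    filter_upwards [eventually_ge_atTop 1] with t ht
    rw [Real.norm_eq_abs, Real.norm_of_nonneg (by positivity)]
    exact h t ht
  have h2 : (fun t : ℝ => t ^ (-q)) =o[atTop] fun t : ℝ => t ^ (-p) := by
    refine isLittleO_of_tendsto' ?_ ((tendsto_rpow_neg_atTop (sub_pos.2 hpq)).congr' ?_)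
    · filter_upwards [eventually_gt_atTop 0] with t ht h
      exact absurd h (Real.rpow_pos_of_pos ht _).ne'
    · filter_upwards [eventually_gt_atTop 0] with t ht
      rw [← Real.rpow_sub ht]
      congr 1
      ring
  refine (h1.trans_isLittleO h2).congr' EventuallyEq.rfl ?_
  filter_upwards [eventually_ge_atTop 0] with t ht
  rw [Real.rpow_neg ht, one_div]

lemma mathieuFun_at_zero {α : ℕ} (hα0 : 0 < α) (a : ℕ) (s : ℝ) {t : ℝ} (ht : 0 ≤ t) :
    mathieuFun α a s t 0 = 0 ^ a / t ^ (α * s) := by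
  rw [mathieuFun, zero_pow hα0.ne', zero_add, ← Real.rpow_natCast t, ← Real.rpow_mul ht, mul_neg,
    Real.rpow_neg ht, div_eq_mul_inv]

theorem mainTheorem12 (γ α : ℕ) (μ : ℝ) (hγ : Even γ) (hα : Even α) (hα0 : 0 < α)
    (hδ : 0 < (α : ℝ) * (μ + 1) - γ) :
    ((∀ t : ℝ, 0 ≤ t →
        Summable (altMathieuTerm t 0 γ α μ) (SummationFilter.conditional ℕ)) ∧
      ∀ n : ℕ,
        (fun t : ℝ => altMathieuS t 0 γ α μ -
            (-1) ^ γ * eulerPolynomial γ 0 / t ^ ((α : ℝ) * (μ + 1)))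
          =o[atTop] fun t : ℝ => 1 / t ^ ((α : ℝ) * (n + μ + 1))) ∧
    (1 < (α : ℝ) * (μ + 1) - γ →
      (∀ t : ℝ, 0 ≤ t → Summable (mathieuTerm t 0 γ α μ)) ∧
      ∀ n : ℕ,
        (fun t : ℝ => mathieuS t 0 γ α μ -
            (1 / t ^ ((α : ℝ) * (μ + 1) - γ - 1) *
                (2 / (α : ℝ) *
                  ProbabilityTheory.beta (((γ : ℝ) + 1) / α) (μ + 1 - ((γ : ℝ) + 1) / α)) +
              (-1) ^ γ * 2 * Polynomial.aeval (0 : ℝ) (Polynomial.bernoulli (γ + 1)) /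
                (((γ : ℝ) + 1) * t ^ ((α : ℝ) * (μ + 1)))))
          =o[atTop] fun t : ℝ => 1 / t ^ ((α : ℝ) * (n + μ + 1))) := by
  -- With `m = α * n + γ + 2`, the `γ` cancels the one in `δ` and the error exponent exceeds the
  -- target by `1/2`.
  have hexp : ∀ n : ℕ, (α : ℝ) * (n + μ + 1) <
      α * (μ + 1) - γ + ((α * n + γ + 2 : ℕ) : ℝ) - 3 / 2 := fun n => by
    push_cast
    linarith
  refine ⟨⟨fun t ht => summable_altMathieuTerm hγ hα hα0 hδ ht, fun n => ?_⟩,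
    fun hδ1 => ⟨fun t ht => summable_mathieuTerm hα hα0 hδ1 ht, fun n => ?_⟩⟩
  · obtain ⟨C, -, H⟩ := tendsto_sum_altMathieuTerm hγ hα hα0 hδ (m := α * n + γ + 2) (by omega)
    refine isLittleO_one_div_rpow_of_abs_le (C := C) (hexp n) fun t ht => ?_
    have ht0 : 0 < t := by linarith
    obtain ⟨L, hL, hLb⟩ := H t ht0
    rw [altMathieuS, hL.tsum_eq, mathieuFun_at_zero hα0 _ _ ht0.le, hγ.neg_one_pow, one_mul,
      eulerPolynomial_zero_of_even hγ, sub_sub_cancel_left, abs_neg]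
    exact hLb ht
  · obtain ⟨C, H⟩ := exists_abs_mathieuS_sub_le hγ hα hα0 hδ1 (m := α * n + γ + 2) (by omega)
    refine isLittleO_one_div_rpow_of_abs_le (C := C) (hexp n) fun t ht => ?_
    have ht0 : 0 < t := by linarith
    refine (le_of_eq ?_).trans (H t ht)
    rw [mathieuFun_at_zero hα0 _ _ ht0.le, integral_Ioi_mathieuFun hα _ ht0,
      integral_Ioi_mathieuFun_one hα0 hδ1, hγ.neg_one_pow, one_mul, ← div_div,
      two_mul_aeval_zero_bernoulli_succ_of_even hγ, Real.rpow_neg ht0.le]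
    congr 1
    ring
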